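/- \textbf{Theorem (Comparison of distributions).} There is a function $C:\mathbb{R}\times\mathbb{R}\to(0,\infty)$ such that the following holds. Let $p\ge 2$, and let $X=(X_1,\dots,X_p)^T$ and $Y=(Y_1,\dots,Y_p)^T$ be centered Gaussian random vectors in $\mathbb{R}^p$ (possibly degenerate, and not necessarily defined on the same probability space) with covariance matrices $\Sigma^X=(\sigma^X_{jk})_{1\le j,k\le p}$ and $\Sigma^Y=(\sigma^Y_{jk})_{1\le j,k\le p}$, and suppose that $\sigma^Y_{jj}>0$ for all $1\le j\le p$. Put $\Delta:=\max_{1\le j,k\le p}|\sigma^X_{jk}-\sigma^Y_{jk}|$. Then $$\sup_{x\in\mathbb{R}}\Bigl|\Pr\bigl(\max_{1\le j\le p}X_j\le x\bigr)-\Pr\bigl(\max_{1\le j\le p}Y_j\le x\bigr)\Bigr|\le C\,\Delta^{1/3}\bigl(1\vee\log(p/\Delta)\bigr)^{2/3},$$ where $C=C\bigl(\min_{1\le j\le p}\sigma^Y_{jj},\,\max_{1\le j\le p}\sigma^Y_{jj}\bigr)$ depends only on the minimal and the maximal diagonal entries of $\Sigma^Y$, $a\vee b:=\max\{a,b\}$,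 and the right side is understood to be $0$ when $\Delta=0$. -/

import Mathlib

open MeasureTheory ProbabilityTheory

noncomputable section

/-- The covariance matrix `(cov(X_j, X_k))_{j,k}` of a random vector `X` in `ℝ^p`. -/
def covarianceMatrix {Ω : Type*} [MeasurableSpace Ω] {p : ℕ} (X : Ω → Fin p → ℝ)
    (P : Measure Ω) : Matrix (Fin p) (Fin p) ℝ :=
  Matrix.of fun j k => cov[fun ω => X ω j, fun ω => X ω k; P]

/-- A centered Gaussian random vector in `ℝ^p` (the law may be degenerate). -/
structure IsCenteredGaussianVector {Ω : Type*} [MeasurableSpace Ω] {p : ℕ} (X : Ω → Fin p → ℝ)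
    (P : Measure Ω) : Prop where
  hasGaussianLaw : HasGaussianLaw X P
  centered : ∀ j, ∫ ω, X ω j ∂P = 0

/-- The largest entry `max_j z_j` of a vector `z` in `ℝ^p` (used for `p ≥ 1`). -/
def maxCoord {p : ℕ} (z : Fin p → ℝ) : ℝ := ⨆ j, z j

/-- The maximal entrywise difference `max_{j,k} |A_{jk} - B_{jk}|` of two `p × p` matrices
(used for `p ≥ 1`). -/
def maxEntryDiff {p : ℕ} (A B : Matrix (Fin p) (Fin p) ℝ) : ℝ := ⨆ j, ⨆ k, |A j k - B j k|

/-- The Kolmogorov distance `sup_x |P(ξ ≤ x) - Q(η ≤ x)|` between (the distributions of) two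
real random variables, which may live on different probability spaces. -/
def kolmogorovDist {Ω Ω' : Type*} [MeasurableSpace Ω] [MeasurableSpace Ω'] (ξ : Ω → ℝ)
    (P : Measure Ω) (η : Ω' → ℝ) (Q : Measure Ω') : ℝ :=
  ⨆ x : ℝ, |P.real {ω | ξ ω ≤ x} - Q.real {ω | η ω ≤ x}|

/-- The quantity `Δ^{1/3} (1 ∨ log (p/Δ))^{2/3}`, understood to be `0` when `Δ = 0`. -/
def comparisonRate (p : ℕ) (Δ : ℝ) : ℝ :=
  if Δ = 0 then 0
  else Δ ^ (1 / 3 : ℝ) * (max 1 (Real.log (p / Δ))) ^ (2 / 3 : ℝ)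

end

open MeasureTheory ProbabilityTheory

/-! The indicator of `max ≤ x` is replaced by a smooth step of width δ applied to the log-sum-exp
`softMax b`, which exceeds the maximum by at most `log p / b`. Expectations of the smoothed function
under two centered Gaussian laws are compared by Lindeberg replacement: each law is an n-fold
convolution of copies scaled to covariance 1/n, and swapping one factor costs the difference of the
second-order Taylor terms, which see the laws only through their covariances, plus O(n^(-3/2)).
Gibbs weights form a probability vector, so these terms differ by at most a multiple of Δ free of p,
and n → ∞ leaves a bound of order Δ (δ⁻² + b δ⁻¹) (`abs_integral_softMax_sub_le`).

Returning to indicators costs the probability that the maximum of Y falls in a window of length 2δ.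
Splitting according to the coordinate attaining the maximum, and using that this coordinate is
independent of its regression residuals, bounds this by a multiple of δ (1 + |x|), again free of p
(`measureReal_max_mem_Ioc_le`). With L = 1 ∨ log (p/Δ), levels |x| beyond order √L are covered by
Gaussian tails, at cost 2p exp(-L) ≤ 2Δ (`measureReal_max_mem_Ioc_le_log`).

Taking b = log p / δ, the total is of order Δ L / δ² + δ √L + Δ, and δ = Δ^(1/3) L^(1/6) balances it
at the claimed rate. Anti-concentration is used for Y alone, so X may be degenerate. -/

/-! ### A smooth step function and a Taylor remainder -/

theorem exists_smooth_step : ∃ K : ℝ, 0 < K ∧ ∃ h h₁ h₂ h₃ : ℝ → ℝ,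
    (∀ u, HasDerivAt h (h₁ u) u) ∧ (∀ u, HasDerivAt h₁ (h₂ u) u) ∧ (∀ u, HasDerivAt h₂ (h₃ u) u) ∧
    (∀ u, |h₁ u| ≤ K) ∧ (∀ u, |h₂ u| ≤ K) ∧ (∀ u, |h₃ u| ≤ K) ∧
    (∀ u, 0 ≤ h u) ∧ (∀ u, h u ≤ 1) ∧ (∀ u ≤ 0, h u = 1) ∧ (∀ u, 1 ≤ u → h u = 0) := by
  set h : ℝ → ℝ := fun u => Real.smoothTransition (1 - u) with hh
  have c : ContDiff ℝ (3 : ℕ∞) h := by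
    exact Real.smoothTransition.contDiff.comp (contDiff_const.sub contDiff_id)
  have c3 : ContDiff ℝ (2 + 1) h := by
    refine c.of_le ?_
    norm_cast
  have c2 : ContDiff ℝ (1 + 1) (deriv h) := (contDiff_succ_iff_deriv.1 c3).2.2
  have c1 : ContDiff ℝ (0 + 1) (deriv (deriv h)) := (contDiff_succ_iff_deriv.1 c2).2.2
  have c0 : ContDiff ℝ 0 (deriv (deriv (deriv h))) := (contDiff_succ_iff_deriv.1 c1).2.2
  have hs : HasCompactSupport (deriv h) := by
    refine HasCompactSupport.intro (isCompact_Icc (a := (0 : ℝ)) (b := 1)) fun u hu => ?_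
    rw [Set.mem_Icc, not_and_or, not_le, not_le] at hu
    rcases hu with hu | hu
    · have : h =ᶠ[nhds u] fun _ => (1 : ℝ) := by
        filter_upwards [eventually_lt_nhds hu] with v hv
        exact Real.smoothTransition.one_of_one_le (by linarith)
      rw [this.deriv_eq]; simp
    · have : h =ᶠ[nhds u] fun _ => (0 : ℝ) := by
        filter_upwards [eventually_gt_nhds hu] with v hv
        exact Real.smoothTransition.zero_of_nonpos (by linarith)
      rw [this.deriv_eq]; simp
  obtain ⟨K₁, hK₁⟩ := c2.continuous.bounded_above_of_compact_support hs
  obtain ⟨K₂, hK₂⟩ := c1.continuous.bounded_above_of_compact_support hs.deriv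
  obtain ⟨K₃, hK₃⟩ := c0.continuous.bounded_above_of_compact_support hs.deriv.deriv
  have hd : ∀ {g : ℝ → ℝ} {n : WithTop ℕ∞}, ContDiff ℝ (n + 1) g → ∀ u, HasDerivAt g (deriv g u) u :=
    fun hg u => ((contDiff_succ_iff_deriv.1 hg).1 u).hasDerivAt
  refine ⟨max 1 (max K₁ (max K₂ K₃)), by positivity, h, _, _, _, hd c3, hd c2, hd c1, fun u => ?_,
    fun u => ?_, fun u => ?_, fun u => Real.smoothTransition.nonneg _,
    fun u => Real.smoothTransition.le_one _,
    fun u hu => Real.smoothTransition.one_of_one_le (by linarith),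
    fun u hu => Real.smoothTransition.zero_of_nonpos (by linarith)⟩
  · exact (hK₁ u).trans (by simp)
  · exact (hK₂ u).trans (by simp)
  · exact (hK₃ u).trans (by simp)

/-- Three successive mean value estimates on [0, 1]. The sharp factor 1/6 is given up, since this
remainder disappears in the Lindeberg limit. -/
theorem abs_sub_taylor_two_le {g g₁ g₂ g₃ : ℝ → ℝ} {K : ℝ}
    (h₁ : ∀ s, HasDerivAt g (g₁ s) s) (h₂ : ∀ s, HasDerivAt g₁ (g₂ s) s)
    (h₃ : ∀ s, HasDerivAt g₂ (g₃ s) s) (hK : ∀ s, |g₃ s| ≤ K) :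
    |g 1 - g 0 - g₁ 0 - g₂ 0 / 2| ≤ K := by
  have K0 : 0 ≤ K := (abs_nonneg _).trans (hK 0)
  have step : ∀ {f f' : ℝ → ℝ}, (∀ s, HasDerivAt f (f' s) s) →
      (∀ s ∈ Set.Icc (0 : ℝ) 1, |f' s| ≤ K) → f 0 = 0 → ∀ s ∈ Set.Icc (0 : ℝ) 1, |f s| ≤ K := by
    intro f f' hf hb h0 s hs
    have := (convex_Icc (0 : ℝ) 1).norm_image_sub_le_of_norm_hasDerivWithin_le
      (fun x _ => (hf x).hasDerivWithinAt) hb (Set.left_mem_Icc.2 zero_le_one) hs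
    simp only [h0, sub_zero, Real.norm_eq_abs] at this
    refine this.trans (mul_le_of_le_one_right K0 ?_)
    rw [abs_of_nonneg hs.1]; exact hs.2
  have a := step (f := fun s => g₂ s - g₂ 0) (fun s => (h₃ s).sub_const _) (fun s _ => hK s) (by simp)
  have b := step (f := fun s => g₁ s - g₁ 0 - g₂ 0 * s) (f' := fun s => g₂ s - g₂ 0)
    (fun s => by
      convert! ((h₂ s).sub_const (g₁ 0)).sub ((hasDerivAt_id s).const_mul (g₂ 0)) using 1
      simp) a (by simp)
  have c := step (f := fun s => g s - g 0 - g₁ 0 * s - g₂ 0 * (s ^ 2 / 2))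
    (f' := fun s => g₁ s - g₁ 0 - g₂ 0 * s)
    (fun s => by
      convert! (((h₁ s).sub_const (g 0)).sub ((hasDerivAt_id s).const_mul (g₁ 0))).sub
        ((((hasDerivAt_id s).pow 2).div_const 2).const_mul (g₂ 0)) using 1
      simp) b (by simp) 1 (by simp)
  convert c using 2
  ring

/-! ### Calculus of the log-sum-exp function -/

variable {p : ℕ}

/-- The log-sum-exp approximation of the maximum of the coordinates. -/
noncomputable def softMax (b : ℝ) (z : Fin p → ℝ) : ℝ := Real.log (∑ j, Real.exp (b * z j)) / b

/-- The Gibbs average of `z ^ k` with weights proportional to `exp (b * w j)`. -/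
noncomputable def gibbsMoment (b : ℝ) (w z : Fin p → ℝ) (k : ℕ) : ℝ :=
  (∑ j, z j ^ k * Real.exp (b * w j)) / ∑ j, Real.exp (b * w j)

theorem sum_exp_pos [NeZero p] (b : ℝ) (w : Fin p → ℝ) : 0 < ∑ j, Real.exp (b * w j) :=
  Finset.sum_pos (fun _ _ => Real.exp_pos _) Finset.univ_nonempty

theorem abs_gibbsMoment_le [NeZero p] (b : ℝ) (w z : Fin p → ℝ) (k : ℕ) :
    |gibbsMoment b w z k| ≤ ‖z‖ ^ k := by
  rw [gibbsMoment, abs_div, abs_of_pos (sum_exp_pos b w), div_le_iff₀ (sum_exp_pos b w),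
    Finset.mul_sum]
  refine (Finset.abs_sum_le_sum_abs _ _).trans (Finset.sum_le_sum fun j _ => ?_)
  rw [abs_mul, abs_of_pos (Real.exp_pos _), abs_pow]
  gcongr
  exact norm_le_pi_norm z j

theorem hasDerivAt_sum_exp (b : ℝ) (w z : Fin p → ℝ) (k : ℕ) (s : ℝ) :
    HasDerivAt (fun s => ∑ j, z j ^ k * Real.exp (b * (w + s • z) j))
      (b * ∑ j, z j ^ (k + 1) * Real.exp (b * (w + s • z) j)) s := by
  rw [Finset.mul_sum]
  refine HasDerivAt.fun_sum fun j _ => ?_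
  have : HasDerivAt (fun s : ℝ => b * (w + s • z) j) (b * z j) s := by
    simpa using (((hasDerivAt_id s).mul_const (z j)).const_add (w j)).const_mul b
  convert! (this.exp.const_mul (z j ^ k)) using 1
  ring

/-- Moments are closed under differentiation along a line, so every directional derivative of
`softMax` is a polynomial in moments bounded by powers of ‖z‖. -/
theorem hasDerivAt_gibbsMoment [NeZero p] (b : ℝ) (w z : Fin p → ℝ) (k : ℕ) (s : ℝ) :
    HasDerivAt (fun s => gibbsMoment b (w + s • z) z k)
      (b * (gibbsMoment b (w + s • z) z (k + 1) -
        gibbsMoment b (w + s • z) z k * gibbsMoment b (w + s • z) z 1)) s := by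
  have h0 := hasDerivAt_sum_exp b w z 0 s
  simp only [pow_zero, one_mul, zero_add] at h0
  have := (hasDerivAt_sum_exp b w z k s).div h0 (sum_exp_pos b (w + s • z)).ne'
  convert! this using 1
  have := (sum_exp_pos b (w + s • z)).ne'
  simp only [gibbsMoment]
  field_simp

theorem hasDerivAt_softMax [NeZero p] {b : ℝ} (hb : b ≠ 0) (w z : Fin p → ℝ) (s : ℝ) :
    HasDerivAt (fun s => softMax b (w + s • z)) (gibbsMoment b (w + s • z) z 1) s := by
  have h0 := hasDerivAt_sum_exp b w z 0 s
  simp only [pow_zero, one_mul, zero_add] at h0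
  convert! (h0.log (sum_exp_pos b (w + s • z)).ne').div_const b using 1
  simp only [gibbsMoment]
  field_simp

theorem le_softMax [NeZero p] {b : ℝ} (hb : 0 < b) (z : Fin p → ℝ) (j : Fin p) :
    z j ≤ softMax b z := by
  rw [softMax, le_div_iff₀ hb, Real.le_log_iff_exp_le (sum_exp_pos b z), mul_comm]
  exact Finset.single_le_sum (f := fun j => Real.exp (b * z j)) (fun _ _ => (Real.exp_pos _).le)
    (Finset.mem_univ j)

theorem softMax_le [NeZero p] {b : ℝ} (hb : 0 < b) (z : Fin p → ℝ) (x : ℝ) (hz : ∀ j, z j ≤ x) :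
    softMax b z ≤ x + Real.log p / b := by
  have hp : (0 : ℝ) < p := by exact_mod_cast Nat.pos_of_ne_zero (NeZero.ne p)
  rw [softMax, div_le_iff₀ hb, Real.log_le_iff_le_exp (sum_exp_pos b z), add_mul,
    div_mul_cancel₀ _ hb.ne', Real.exp_add, Real.exp_log hp]
  calc ∑ j, Real.exp (b * z j) ≤ ∑ _j : Fin p, Real.exp (x * b) := by
        refine Finset.sum_le_sum fun j _ => Real.exp_le_exp.2 ?_
        rw [mul_comm]; exact mul_le_mul_of_nonneg_right (hz j) hb.le
    _ = _ := by simp [mul_comm]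

theorem continuous_softMax [NeZero p] (b : ℝ) : Continuous (softMax b : (Fin p → ℝ) → ℝ) := by
  refine Continuous.div_const (Continuous.log (by fun_prop) fun z => (sum_exp_pos b z).ne') _

theorem abs_softMax_taylor_le [NeZero p] {b : ℝ} (hb : 0 < b) {h h₁ h₂ h₃ : ℝ → ℝ} {K : ℝ}
    (d₁ : ∀ u, HasDerivAt h (h₁ u) u) (d₂ : ∀ u, HasDerivAt h₁ (h₂ u) u)
    (d₃ : ∀ u, HasDerivAt h₂ (h₃ u) u)
    (k₁ : ∀ u, |h₁ u| ≤ K) (k₂ : ∀ u, |h₂ u| ≤ K) (k₃ : ∀ u, |h₃ u| ≤ K) (w z : Fin p → ℝ) :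
    |h (softMax b (w + z)) - h (softMax b w) - h₁ (softMax b w) * gibbsMoment b w z 1
      - (h₂ (softMax b w) * gibbsMoment b w z 1 ^ 2 + h₁ (softMax b w) *
        (b * (gibbsMoment b w z 2 - gibbsMoment b w z 1 ^ 2))) / 2|
      ≤ K * (1 + 6 * b + 6 * b ^ 2) * ‖z‖ ^ 3 := by
  set F : ℝ → ℝ := fun s => softMax b (w + s • z)
  set M : ℕ → ℝ → ℝ := fun k s => gibbsMoment b (w + s • z) z k
  have hM : ∀ k s, |M k s| ≤ ‖z‖ ^ k := fun k s => abs_gibbsMoment_le _ _ _ _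
  have dF : ∀ s, HasDerivAt F (M 1 s) s := hasDerivAt_softMax hb.ne' w z
  have dM : ∀ k s, HasDerivAt (M k) (b * (M (k + 1) s - M k s * M 1 s)) s :=
    hasDerivAt_gibbsMoment b w z
  have K0 : 0 ≤ K := (abs_nonneg _).trans (k₁ 0)
  have e₁ : ∀ s, HasDerivAt (fun s => h (F s)) (h₁ (F s) * M 1 s) s :=
    fun s => (d₁ _).comp s (dF s)
  have e₂ : ∀ s, HasDerivAt (fun s => h₁ (F s) * M 1 s)
      (h₂ (F s) * M 1 s ^ 2 + h₁ (F s) * (b * (M 2 s - M 1 s ^ 2))) s := fun s => by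
    convert! ((d₂ _).comp s (dF s)).mul (dM 1 s) using 1
    simp only [Function.comp]; ring
  have e₃ : ∀ s, HasDerivAt
      (fun s => h₂ (F s) * M 1 s ^ 2 + h₁ (F s) * (b * (M 2 s - M 1 s ^ 2)))
      (h₃ (F s) * M 1 s ^ 3 + 3 * (h₂ (F s) * M 1 s * (b * (M 2 s - M 1 s ^ 2)))
        + h₁ (F s) * (b ^ 2 * (M 3 s - 3 * (M 2 s * M 1 s) + 2 * M 1 s ^ 3))) s := fun s => by
    convert! (((d₃ _).comp s (dF s)).mul ((dM 1 s).pow 2)).add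
      (((d₂ _).comp s (dF s)).mul (((dM 2 s).sub ((dM 1 s).pow 2)).const_mul b)) using 1
    simp only [Function.comp]; norm_num; ring
  have := abs_sub_taylor_two_le e₁ e₂ e₃ (K := K * (1 + 6 * b + 6 * b ^ 2) * ‖z‖ ^ 3) fun s => by
    set r := ‖z‖
    have r0 : 0 ≤ r := norm_nonneg z
    have m1 : |M 1 s| ≤ r := by simpa using hM 1 s
    have m2 := hM 2 s
    have m3 := hM 3 s
    have m11 : |M 1 s ^ 2| ≤ r ^ 2 := by rw [abs_pow]; gcongr
    have m111 : |M 1 s ^ 3| ≤ r ^ 3 := by rw [abs_pow]; gcongr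
    have m21 : |M 2 s * M 1 s| ≤ r ^ 3 := by
      rw [abs_mul, pow_succ]; gcongr
    have v : |M 2 s - M 1 s ^ 2| ≤ 2 * r ^ 2 := (abs_sub _ _).trans (by linarith)
    have t : |M 3 s - 3 * (M 2 s * M 1 s) + 2 * M 1 s ^ 3| ≤ 6 * r ^ 3 := by
      rw [abs_le] at *; constructor <;> linarith
    have a1 : |h₃ (F s) * M 1 s ^ 3| ≤ K * r ^ 3 := by
      rw [abs_mul]; gcongr; exact k₃ _
    have a2 : |h₂ (F s) * M 1 s * (b * (M 2 s - M 1 s ^ 2))| ≤ K * r * (b * (2 * r ^ 2)) := by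
      rw [abs_mul, abs_mul, abs_mul, abs_of_pos hb]; gcongr; exact k₂ _
    have a3 : |h₁ (F s) * (b ^ 2 * (M 3 s - 3 * (M 2 s * M 1 s) + 2 * M 1 s ^ 3))|
        ≤ K * (b ^ 2 * (6 * r ^ 3)) := by
      rw [abs_mul, abs_mul, abs_of_pos (by positivity : 0 < b ^ 2)]; gcongr; exact k₁ _
    -- The coefficients 1, 3 · 2 and 6 come from `a1`, `a2` and `a3`.
    have : K * (1 + 6 * b + 6 * b ^ 2) * r ^ 3 =
      K * r ^ 3 + 3 * (K * r * (b * (2 * r ^ 2))) + K * (b ^ 2 * (6 * r ^ 3)) := by ring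
    rw [this]
    rw [abs_le] at a1 a2 a3 ⊢
    constructor <;> linarith
  simpa [F, M] using this

/-- The Gibbs weights proportional to `exp (b * w j)`. -/
noncomputable def gibbsWeight (b : ℝ) (w : Fin p → ℝ) (j : Fin p) : ℝ :=
  Real.exp (b * w j) / ∑ j, Real.exp (b * w j)

theorem gibbsWeight_nonneg (b : ℝ) (w : Fin p → ℝ) (j : Fin p) : 0 ≤ gibbsWeight b w j := by
  unfold gibbsWeight; positivity

theorem sum_gibbsWeight [NeZero p] (b : ℝ) (w : Fin p → ℝ) : ∑ j, gibbsWeight b w j = 1 := by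
  simp only [gibbsWeight, ← Finset.sum_div]
  exact div_self (sum_exp_pos b w).ne'

theorem gibbsMoment_eq (b : ℝ) (w z : Fin p → ℝ) (k : ℕ) :
    gibbsMoment b w z k = ∑ j, gibbsWeight b w j * z j ^ k := by
  simp only [gibbsMoment, gibbsWeight, Finset.sum_div]
  exact Finset.sum_congr rfl fun j _ => by ring

theorem gibbsMoment_smul (b : ℝ) (w z : Fin p → ℝ) (c : ℝ) (k : ℕ) :
    gibbsMoment b w (c • z) k = c ^ k * gibbsMoment b w z k := by
  simp only [gibbsMoment_eq, Finset.mul_sum, Pi.smul_apply, smul_eq_mul, mul_pow]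
  exact Finset.sum_congr rfl fun j _ => by ring

/-! ### Gaussian expectations and a single replacement step -/

theorem memLp_eval (μ : Measure (Fin p → ℝ)) [IsGaussian μ] (j : Fin p) :
    MemLp (fun z : Fin p → ℝ => z j) 2 μ :=
  IsGaussian.memLp_dual μ (ContinuousLinearMap.proj j) 2 (by simp)

theorem integrable_eval_mul (μ : Measure (Fin p → ℝ)) [IsGaussian μ] (j k : Fin p) :
    Integrable (fun z : Fin p → ℝ => z j * z k) μ :=
  (memLp_eval μ j).integrable_mul (memLp_eval μ k)

theorem integral_gibbsMoment_one (μ : Measure (Fin p → ℝ)) [IsGaussian μ]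
    (h0 : ∀ j, ∫ z, z j ∂μ = 0) (b : ℝ) (w : Fin p → ℝ) :
    Integrable (fun z => gibbsMoment b w z 1) μ ∧ ∫ z, gibbsMoment b w z 1 ∂μ = 0 := by
  simp only [gibbsMoment_eq, pow_one]
  have hi : ∀ j, Integrable (fun z : Fin p → ℝ => gibbsWeight b w j * z j) μ := fun j =>
    ((memLp_eval μ j).integrable (by norm_num)).const_mul _
  refine ⟨integrable_finsetSum _ fun j _ => hi j, ?_⟩
  rw [integral_finsetSum _ fun j _ => hi j]
  simp [integral_const_mul, h0]

theorem integral_gibbsMoment_two (μ : Measure (Fin p → ℝ)) [IsGaussian μ] (b : ℝ)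
    (w : Fin p → ℝ) :
    Integrable (fun z => gibbsMoment b w z 2) μ ∧
    ∫ z, gibbsMoment b w z 2 ∂μ = ∑ j, gibbsWeight b w j * ∫ z, z j * z j ∂μ := by
  simp only [gibbsMoment_eq, pow_two]
  have hi : ∀ j, Integrable (fun z : Fin p → ℝ => gibbsWeight b w j * (z j * z j)) μ := fun j =>
    (integrable_eval_mul μ j j).const_mul _
  refine ⟨integrable_finsetSum _ fun j _ => hi j, ?_⟩
  rw [integral_finsetSum _ fun j _ => hi j]
  simp [integral_const_mul]

theorem integral_gibbsMoment_one_sq (μ : Measure (Fin p → ℝ)) [IsGaussian μ] (b : ℝ)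
    (w : Fin p → ℝ) :
    Integrable (fun z => gibbsMoment b w z 1 ^ 2) μ ∧
    ∫ z, gibbsMoment b w z 1 ^ 2 ∂μ =
      ∑ j, ∑ k, gibbsWeight b w j * gibbsWeight b w k * ∫ z, z j * z k ∂μ := by
  have e : ∀ z : Fin p → ℝ, gibbsMoment b w z 1 ^ 2 =
      ∑ j, ∑ k, gibbsWeight b w j * gibbsWeight b w k * (z j * z k) := fun z => by
    rw [gibbsMoment_eq, pow_two, Finset.sum_mul_sum]
    exact Finset.sum_congr rfl fun j _ => Finset.sum_congr rfl fun k _ => by ring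
  have hi : ∀ j k, Integrable
      (fun z : Fin p → ℝ => gibbsWeight b w j * gibbsWeight b w k * (z j * z k)) μ := fun j k =>
    (integrable_eval_mul μ j k).const_mul _
  simp only [e]
  refine ⟨integrable_finsetSum _ fun j _ => integrable_finsetSum _ fun k _ => hi j k, ?_⟩
  rw [integral_finsetSum _ fun j _ => integrable_finsetSum _ fun k _ => hi j k]
  refine Finset.sum_congr rfl fun j _ => ?_
  rw [integral_finsetSum _ fun k _ => hi j k]
  simp [integral_const_mul]

/-- The weights sum to one; this is what keeps the comparison free of a factor p. Applied twice, it
handles the double sum over the covariance matrix. -/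
theorem abs_sum_weight_sub_le [NeZero p] (b : ℝ) (w : Fin p → ℝ) {s t : Fin p → ℝ} {Δ : ℝ}
    (h : ∀ j, |s j - t j| ≤ Δ) :
    |∑ j, gibbsWeight b w j * s j - ∑ j, gibbsWeight b w j * t j| ≤ Δ := by
  rw [← Finset.sum_sub_distrib]
  refine (Finset.abs_sum_le_sum_abs _ _).trans ?_
  calc ∑ j, |gibbsWeight b w j * s j - gibbsWeight b w j * t j|
      ≤ ∑ j, gibbsWeight b w j * Δ := Finset.sum_le_sum fun j _ => by
        rw [← mul_sub, abs_mul, abs_of_nonneg (gibbsWeight_nonneg b w j)]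
        exact mul_le_mul_of_nonneg_left (h j) (gibbsWeight_nonneg b w j)
    _ = Δ := by rw [← Finset.sum_mul, sum_gibbsWeight, one_mul]

theorem integrable_norm_pow_three (μ : Measure (Fin p → ℝ)) [IsGaussian μ] :
    Integrable (fun z => ‖z‖ ^ 3) μ :=
  (IsGaussian.memLp_id μ 3 (by simp)).integrable_norm_pow (by norm_num)

theorem integrable_of_mem_Icc (μ : Measure (Fin p → ℝ)) [IsFiniteMeasure μ]
    {f : (Fin p → ℝ) → ℝ} (hf : Continuous f) (h0 : ∀ z, 0 ≤ f z) (h1 : ∀ z, f z ≤ 1) :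
    Integrable f μ :=
  Integrable.of_bound hf.aestronglyMeasurable 1
    (Filter.Eventually.of_forall fun z => by rw [Real.norm_of_nonneg (h0 z)]; exact h1 z)

section

variable {b : ℝ} {h h₁ h₂ h₃ : ℝ → ℝ} {K : ℝ}

/-- The linear Taylor term integrates to zero by centering, and the quadratic one depends on μ only
through its covariances; the remainder is of order c³. -/
theorem abs_integral_softMax_add_smul_sub_le [NeZero p] (hb : 0 < b)
    (d₁ : ∀ u, HasDerivAt h (h₁ u) u) (d₂ : ∀ u, HasDerivAt h₁ (h₂ u) u)
    (d₃ : ∀ u, HasDerivAt h₂ (h₃ u) u)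
    (k₁ : ∀ u, |h₁ u| ≤ K) (k₂ : ∀ u, |h₂ u| ≤ K) (k₃ : ∀ u, |h₃ u| ≤ K)
    (b₀ : ∀ u, 0 ≤ h u) (b₁ : ∀ u, h u ≤ 1)
    (μ : Measure (Fin p → ℝ)) [IsGaussian μ] (h0 : ∀ j, ∫ z, z j ∂μ = 0) (w : Fin p → ℝ)
    {c : ℝ} (hc : 0 ≤ c) :
    |∫ z, h (softMax b (w + c • z)) ∂μ - (h (softMax b w) + c ^ 2 / 2 *
      ((h₂ (softMax b w) - b * h₁ (softMax b w)) *
        (∑ j, ∑ k, gibbsWeight b w j * gibbsWeight b w k * ∫ z, z j * z k ∂μ)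
        + b * h₁ (softMax b w) * ∑ j, gibbsWeight b w j * ∫ z, z j * z j ∂μ))|
      ≤ c ^ 3 * (K * (1 + 6 * b + 6 * b ^ 2) * ∫ z, ‖z‖ ^ 3 ∂μ) := by
  have ch : Continuous h := continuous_iff_continuousAt.2 fun u => (d₁ u).continuousAt
  obtain ⟨i1, e1⟩ := integral_gibbsMoment_one μ h0 b w
  obtain ⟨i2, e2⟩ := integral_gibbsMoment_two μ b w
  obtain ⟨i11, e11⟩ := integral_gibbsMoment_one_sq μ b w
  rw [← e2, ← e11]
  set A := h (softMax b w)
  set A₁ := h₁ (softMax b w)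
  set A₂ := h₂ (softMax b w)
  have j1 : Integrable (fun z => A + A₁ * c * gibbsMoment b w z 1) μ :=
    (integrable_const _).add (i1.const_mul _)
  have j2 : Integrable (fun z => (A₂ - b * A₁) * gibbsMoment b w z 1 ^ 2
      + b * A₁ * gibbsMoment b w z 2) μ := (i11.const_mul _).add (i2.const_mul _)
  have iT : Integrable (fun z => A + A₁ * c * gibbsMoment b w z 1 + c ^ 2 / 2 *
      ((A₂ - b * A₁) * gibbsMoment b w z 1 ^ 2 + b * A₁ * gibbsMoment b w z 2)) μ :=
    j1.add (j2.const_mul _)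
  have eT : ∫ z, (A + A₁ * c * gibbsMoment b w z 1 + c ^ 2 / 2 *
      ((A₂ - b * A₁) * gibbsMoment b w z 1 ^ 2 + b * A₁ * gibbsMoment b w z 2)) ∂μ =
      A + c ^ 2 / 2 * ((A₂ - b * A₁) * ∫ z, gibbsMoment b w z 1 ^ 2 ∂μ
        + b * A₁ * ∫ z, gibbsMoment b w z 2 ∂μ) := by
    rw [integral_add j1 (j2.const_mul _),
      integral_add (integrable_const _) (i1.const_mul _), integral_const_mul, integral_const_mul,
      integral_add (i11.const_mul _) (i2.const_mul _), integral_const_mul, integral_const_mul, e1]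
    simp
  have iF : Integrable (fun z => h (softMax b (w + c • z))) μ :=
    integrable_of_mem_Icc μ (ch.comp ((continuous_softMax b).comp (by fun_prop)))
      (fun _ => b₀ _) (fun _ => b₁ _)
  rw [← eT, ← integral_sub iF iT, ← integral_const_mul, ← integral_const_mul]
  refine abs_integral_le_integral_abs.trans
    (integral_mono (iF.sub iT).abs (((integrable_norm_pow_three μ).const_mul _).const_mul _) ?_)
  intro z
  have := abs_softMax_taylor_le hb d₁ d₂ d₃ k₁ k₂ k₃ w (c • z)
  simp only [gibbsMoment_smul, norm_smul, Real.norm_of_nonneg hc] at this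
  calc _ = _ := by simp only [A, A₁, A₂]; ring_nf
    _ ≤ _ := this
    _ = _ := by ring

theorem abs_integral_softMax_sub_le_of_smul [NeZero p] (hb : 0 < b)
    (d₁ : ∀ u, HasDerivAt h (h₁ u) u) (d₂ : ∀ u, HasDerivAt h₁ (h₂ u) u)
    (d₃ : ∀ u, HasDerivAt h₂ (h₃ u) u)
    (k₁ : ∀ u, |h₁ u| ≤ K) (k₂ : ∀ u, |h₂ u| ≤ K) (k₃ : ∀ u, |h₃ u| ≤ K)
    (b₀ : ∀ u, 0 ≤ h u) (b₁ : ∀ u, h u ≤ 1) {a₁ a₂ : ℝ}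
    (l₁ : ∀ u, |h₁ u| ≤ a₁) (l₂ : ∀ u, |h₂ u| ≤ a₂)
    (μ ν : Measure (Fin p → ℝ)) [IsGaussian μ] [IsGaussian ν]
    (hμ : ∀ j, ∫ z, z j ∂μ = 0) (hν : ∀ j, ∫ z, z j ∂ν = 0) {Δ : ℝ}
    (hΔ : ∀ j k, |∫ z, z j * z k ∂μ - ∫ z, z j * z k ∂ν| ≤ Δ) (w : Fin p → ℝ)
    {c : ℝ} (hc : 0 ≤ c) :
    |∫ z, h (softMax b (w + c • z)) ∂μ - ∫ z, h (softMax b (w + c • z)) ∂ν| ≤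
      c ^ 2 * ((a₂ + 2 * b * a₁) * Δ / 2) + c ^ 3 *
      (K * (1 + 6 * b + 6 * b ^ 2) * (∫ z, ‖z‖ ^ 3 ∂μ + ∫ z, ‖z‖ ^ 3 ∂ν)) := by
  have hm := abs_integral_softMax_add_smul_sub_le hb d₁ d₂ d₃ k₁ k₂ k₃ b₀ b₁ μ hμ w hc
  have hn := abs_integral_softMax_add_smul_sub_le hb d₁ d₂ d₃ k₁ k₂ k₃ b₀ b₁ ν hν w hc
  have q2 := abs_sum_weight_sub_le b w (fun j => hΔ j j)
  have q1 := abs_sum_weight_sub_le b w (fun j => abs_sum_weight_sub_le b w (fun k => hΔ j k))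
  simp only [Finset.mul_sum, ← mul_assoc] at q1
  have hΔ0 : 0 ≤ Δ := (abs_nonneg _).trans q2
  set A₁ := h₁ (softMax b w)
  set A₂ := h₂ (softMax b w)
  set S₁ := ∑ j, ∑ k, gibbsWeight b w j * gibbsWeight b w k * ∫ z, z j * z k ∂μ
  set S₂ := ∑ j, gibbsWeight b w j * ∫ z, z j * z j ∂μ
  set T₁ := ∑ j, ∑ k, gibbsWeight b w j * gibbsWeight b w k * ∫ z, z j * z k ∂ν
  set T₂ := ∑ j, gibbsWeight b w j * ∫ z, z j * z j ∂ν
  have l₁' : |A₁| ≤ a₁ := l₁ _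
  have l₂' : |A₂| ≤ a₂ := l₂ _
  have r1 : |(A₂ - b * A₁) * (S₁ - T₁)| ≤ (a₂ + b * a₁) * Δ := by
    rw [abs_mul]
    have : |A₂ - b * A₁| ≤ a₂ + b * a₁ := by
      refine (abs_sub _ _).trans ?_
      rw [abs_mul, abs_of_pos hb]; gcongr
    exact mul_le_mul this q1 (abs_nonneg _) ((abs_nonneg _).trans this)
  have r2 : |b * A₁ * (S₂ - T₂)| ≤ b * a₁ * Δ := by
    rw [abs_mul, abs_mul, abs_of_pos hb]
    have : 0 ≤ a₁ := (abs_nonneg _).trans l₁'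
    gcongr
  have r : |c ^ 2 / 2 * ((A₂ - b * A₁) * (S₁ - T₁) + b * A₁ * (S₂ - T₂))| ≤
      c ^ 2 / 2 * ((a₂ + b * a₁) * Δ + b * a₁ * Δ) := by
    rw [abs_mul, abs_of_nonneg (by positivity : 0 ≤ c ^ 2 / 2)]
    gcongr
    exact (abs_add_le _ _).trans (add_le_add r1 r2)
  rw [abs_le] at hm hn r ⊢
  constructor <;> linarith

end

/-! ### The Gaussian convolution semigroup and Lindeberg interpolation -/

/-- The law of `√a • Z` when `Z` has law `μ`. -/
noncomputable def timeScale (μ : Measure (Fin p → ℝ)) (a : ℝ) : Measure (Fin p → ℝ) :=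
  μ.map (Real.sqrt a • ContinuousLinearMap.id ℝ (Fin p → ℝ))

instance (μ : Measure (Fin p → ℝ)) [IsGaussian μ] (a : ℝ) : IsGaussian (timeScale μ a) := by
  unfold timeScale; infer_instance

theorem timeScale_zero (μ : Measure (Fin p → ℝ)) [IsProbabilityMeasure μ] :
    timeScale μ 0 = Measure.dirac 0 := by
  have : ((Real.sqrt 0 • ContinuousLinearMap.id ℝ (Fin p → ℝ) : (Fin p → ℝ) →L[ℝ] (Fin p → ℝ)) :
      (Fin p → ℝ) → (Fin p → ℝ)) = fun _ => 0 := by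
    ext; simp
  rw [timeScale, this, Measure.map_const]
  simp

theorem timeScale_one (μ : Measure (Fin p → ℝ)) : timeScale μ 1 = μ := by
  simp [timeScale]

theorem integral_timeScale (μ : Measure (Fin p → ℝ)) (a : ℝ) {f : (Fin p → ℝ) → ℝ}
    (hf : Continuous f) : ∫ z, f z ∂(timeScale μ a) = ∫ z, f (Real.sqrt a • z) ∂μ := by
  rw [timeScale, integral_map (by fun_prop) hf.aestronglyMeasurable]
  simp

theorem integral_dual_eq_zero {μ : Measure (Fin p → ℝ)} [IsGaussian μ]
    (h0 : ∀ j, ∫ z, z j ∂μ = 0) (L : StrongDual ℝ (Fin p → ℝ)) : ∫ z, L z ∂μ = 0 := by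
  rw [IsGaussian.integral_dual]
  have : ∫ z, z ∂μ = 0 := by
    ext j
    exact (eval_integral (fun j => (memLp_eval μ j).integrable (by norm_num)) j).trans (h0 j)
  rw [this, map_zero]

theorem charFunDual_timeScale {μ : Measure (Fin p → ℝ)} [IsGaussian μ]
    (h0 : ∀ j, ∫ z, z j ∂μ = 0) {a : ℝ} (ha : 0 ≤ a) (L : StrongDual ℝ (Fin p → ℝ)) :
    charFunDual (timeScale μ a) L = Complex.exp (-(a * Var[L; μ] : ℝ) / 2) := by
  rw [timeScale, charFunDual_map, IsGaussian.charFunDual_eq_of_forall_strongDual_eq_zero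
    (integral_dual_eq_zero h0)]
  have : ⇑(L.comp (Real.sqrt a • ContinuousLinearMap.id ℝ (Fin p → ℝ))) =
      fun z => Real.sqrt a * L z := by
    ext; simp
  rw [this, variance_const_mul, Real.sq_sqrt ha]

/-- The characteristic function of a centered Gaussian law is the exponential of a multiple of the
variance, and the scaling by √a makes that variance linear in a. -/
theorem timeScale_conv {μ : Measure (Fin p → ℝ)} [IsGaussian μ] (h0 : ∀ j, ∫ z, z j ∂μ = 0)
    {a b : ℝ} (ha : 0 ≤ a) (hb : 0 ≤ b) :
    timeScale μ a ∗ timeScale μ b = timeScale μ (a + b) := by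
  refine Measure.ext_of_charFunDual ?_
  ext L
  rw [charFunDual_conv, charFunDual_timeScale h0 ha, charFunDual_timeScale h0 hb,
    charFunDual_timeScale h0 (add_nonneg ha hb), ← Complex.exp_add]
  congr 1
  push_cast
  ring

section

variable {b : ℝ} {h h₁ h₂ h₃ : ℝ → ℝ} {K : ℝ}

theorem abs_integral_softMax_sub_le [NeZero p] (hb : 0 < b)
    (d₁ : ∀ u, HasDerivAt h (h₁ u) u) (d₂ : ∀ u, HasDerivAt h₁ (h₂ u) u)
    (d₃ : ∀ u, HasDerivAt h₂ (h₃ u) u)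
    (k₁ : ∀ u, |h₁ u| ≤ K) (k₂ : ∀ u, |h₂ u| ≤ K) (k₃ : ∀ u, |h₃ u| ≤ K)
    (b₀ : ∀ u, 0 ≤ h u) (b₁ : ∀ u, h u ≤ 1) {a₁ a₂ : ℝ}
    (l₁ : ∀ u, |h₁ u| ≤ a₁) (l₂ : ∀ u, |h₂ u| ≤ a₂)
    (μ ν : Measure (Fin p → ℝ)) [IsGaussian μ] [IsGaussian ν]
    (hμ : ∀ j, ∫ z, z j ∂μ = 0) (hν : ∀ j, ∫ z, z j ∂ν = 0) {Δ : ℝ}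
    (hΔ : ∀ j k, |∫ z, z j * z k ∂μ - ∫ z, z j * z k ∂ν| ≤ Δ) :
    |∫ z, h (softMax b z) ∂μ - ∫ z, h (softMax b z) ∂ν| ≤ (a₂ + 2 * b * a₁) * Δ / 2 := by
  have ch : Continuous h := continuous_iff_continuousAt.2 fun u => (d₁ u).continuousAt
  have cf : Continuous fun z : Fin p → ℝ => h (softMax b z) := ch.comp (continuous_softMax b)
  set f : (Fin p → ℝ) → ℝ := fun z => h (softMax b z)
  have fi : ∀ (ρ : Measure (Fin p → ℝ)) [IsFiniteMeasure ρ], Integrable f ρ := fun ρ _ =>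
    integrable_of_mem_Icc ρ cf (fun _ => b₀ _) (fun _ => b₁ _)
  set B := (a₂ + 2 * b * a₁) * Δ / 2
  set R := K * (1 + 6 * b + 6 * b ^ 2) * (∫ z, ‖z‖ ^ 3 ∂μ + ∫ z, ‖z‖ ^ 3 ∂ν)
  -- The one-step bound is uniform in the base point w, so it survives averaging w over the common
  -- convolution factor ρ.
  have key : ∀ (ρ : Measure (Fin p → ℝ)) [IsProbabilityMeasure ρ] (a : ℝ), 0 ≤ a →
      |∫ z, f z ∂(ρ ∗ timeScale μ a) - ∫ z, f z ∂(ρ ∗ timeScale ν a)| ≤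
        a * B + Real.sqrt a ^ 3 * R := fun ρ _ a ha => by
    rw [integral_conv (fi _), integral_conv (fi _)]
    have ii : ∀ (τ : Measure (Fin p → ℝ)) [IsProbabilityMeasure τ],
        Integrable (fun w => ∫ z, f (w + z) ∂τ) ρ := fun τ _ => by
      refine Integrable.of_bound (C := 1) ?_ (Filter.Eventually.of_forall fun w => ?_)
      · exact (StronglyMeasurable.integral_prod_right'
          (f := fun q : (Fin p → ℝ) × (Fin p → ℝ) => f (q.1 + q.2))
          (cf.comp continuous_add).stronglyMeasurable).aestronglyMeasurable
      · refine (norm_integral_le_of_norm_le_const (C := 1)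
          (Filter.Eventually.of_forall fun z => ?_)).trans (by simp)
        rw [Real.norm_of_nonneg (b₀ _)]
        exact b₁ _
    rw [← integral_sub (ii _) (ii _)]
    rw [← Real.norm_eq_abs]
    refine (norm_integral_le_of_norm_le_const (C := a * B + Real.sqrt a ^ 3 * R)
      (Filter.Eventually.of_forall fun w => ?_)).trans (by simp)
    rw [Real.norm_eq_abs]
    rw [integral_timeScale μ a (f := fun z => f (w + z)) (by fun_prop),
      integral_timeScale ν a (f := fun z => f (w + z)) (by fun_prop)]
    have := abs_integral_softMax_sub_le_of_smul hb d₁ d₂ d₃ k₁ k₂ k₃ b₀ b₁ l₁ l₂ μ ν hμ hν hΔ w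
      (Real.sqrt_nonneg a)
    rwa [Real.sq_sqrt ha] at this
  have main : ∀ n : ℕ, 0 < n → |∫ z, f z ∂μ - ∫ z, f z ∂ν| ≤ B + R * Real.sqrt (1 / n) :=
      fun n hn => by
    have hn' : (0 : ℝ) < n := by exact_mod_cast hn
    -- A path of laws from ν to μ; consecutive ones share a factor and differ by exchanging a
    -- 1/n-piece of ν for one of μ.
    set γ : ℕ → Measure (Fin p → ℝ) := fun k =>
      timeScale μ ((k : ℝ) / n) ∗ timeScale ν (1 - (k : ℝ) / n)
    have stp : ∀ k < n, dist (∫ z, f z ∂(γ k)) (∫ z, f z ∂(γ (k + 1))) ≤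
        1 / n * B + Real.sqrt (1 / n) ^ 3 * R := fun k hk => by
      have hk' : (k : ℝ) + 1 ≤ n := by exact_mod_cast hk
      have hr : 0 ≤ 1 - ((k : ℝ) + 1) / n := by
        rw [sub_nonneg, div_le_one hn']; exact hk'
      have g1 : γ (k + 1) = (timeScale μ ((k : ℝ) / n) ∗ timeScale ν (1 - ((k : ℝ) + 1) / n)) ∗
          timeScale μ (1 / n) := by
        rw [Measure.conv_assoc, Measure.conv_comm (timeScale ν _), ← Measure.conv_assoc,
          timeScale_conv hμ (by positivity) (by positivity), ← add_div]
        simp [γ]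
      have g0 : γ k = (timeScale μ ((k : ℝ) / n) ∗ timeScale ν (1 - ((k : ℝ) + 1) / n)) ∗
          timeScale ν (1 / n) := by
        rw [Measure.conv_assoc, timeScale_conv hν hr (by positivity)]
        simp only [γ]
        congr 2
        ring
      rw [g0, g1, dist_comm, Real.dist_eq]
      exact key _ _ (by positivity)
    have := dist_le_range_sum_of_dist_le n (f := fun k => ∫ z, f z ∂(γ k)) (d := fun _ =>
      1 / n * B + Real.sqrt (1 / n) ^ 3 * R) (fun {k} hk => stp k hk)
    have e0 : γ 0 = ν := by
      simp [γ, timeScale_zero, timeScale_one]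
    have e1 : γ n = μ := by
      simp [γ, timeScale_zero, timeScale_one, div_self hn'.ne']
    simp only [e0, e1, Finset.sum_const, Finset.card_range, nsmul_eq_mul] at this
    rw [dist_comm, Real.dist_eq] at this
    -- The n remainders of size n^(-3/2) R add up to n^(-1/2) R.
    refine this.trans_eq ?_
    rw [pow_succ, Real.sq_sqrt (by positivity)]
    field_simp
  refine ge_of_tendsto (x := Filter.atTop)
    (f := fun n : ℕ => B + R * Real.sqrt (1 / n)) ?_ ?_
  · have : Filter.Tendsto (fun n : ℕ => B + R * Real.sqrt (1 / n)) Filter.atTop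
        (nhds (B + R * Real.sqrt 0)) :=
      ((Real.continuous_sqrt.tendsto 0).comp tendsto_one_div_atTop_nhds_zero_nat).const_mul R
        |>.const_add B
    simpa using this
  · filter_upwards [Filter.eventually_gt_atTop 0] with n hn using main n hn

end

/-! ### Anti-concentration of the Gaussian maximum -/

/-- The density varies by at most a constant factor over distances of order 1/(1 + A) near the
window. Hence the tail beyond a + e has mass at least a constant times φ(a + e)/(1 + A), against at
most a constant times e φ(a + e) in the window. Bounding by the tail, not by 1, is what later allows
summing over coordinates. -/
theorem gaussianReal_Ioc_le_mul_Ioi {a e A : ℝ} (he : 0 ≤ e) (ha : |a| ≤ A)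
    (hA : e * (1 + A) ≤ 1) :
    (gaussianReal 0 1).real (Set.Ioc a (a + e)) ≤
      Real.exp 3 * (e * (1 + A)) * (gaussianReal 0 1).real (Set.Ioi (a + e)) := by
  have A0 : 0 ≤ A := (abs_nonneg a).trans ha
  obtain ⟨ha1, ha2⟩ := abs_le.1 ha
  have e1 : e ≤ 1 := by nlinarith
  set φ := gaussianPDFReal 0 1
  have hφ : ∀ x, φ x = (Real.sqrt (2 * Real.pi))⁻¹ * Real.exp (-(x ^ 2 / 2)) := fun x => by
    simp [φ, gaussianPDFReal_def, neg_div]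
  have hP : ∀ s, (gaussianReal 0 1).real s = ∫ x in s, φ x := fun s => by
    rw [measureReal_def, gaussianReal_apply_eq_integral 0 one_ne_zero, ENNReal.toReal_ofReal]
    exact integral_nonneg fun x => gaussianPDFReal_nonneg 0 1 x
  have hi : Integrable φ := integrable_gaussianPDFReal 0 1
  have cmp : ∀ {u v : ℝ} (d : ℝ), v ^ 2 / 2 ≤ d + u ^ 2 / 2 → φ u ≤ Real.exp d * φ v :=
    fun {u v} d h => by
      rw [hφ, hφ, mul_left_comm, ← Real.exp_add]
      gcongr
      linarith
  set c := a + e with hc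
  have up : (gaussianReal 0 1).real (Set.Ioc a c) ≤ e * (Real.exp 1 * φ c) := by
    rw [hP]
    have : ∫ x in Set.Ioc a c, φ x ≤ ∫ x in Set.Ioc a c, Real.exp 1 * φ c := by
      refine setIntegral_mono_on hi.integrableOn continuous_const.integrableOn_Ioc measurableSet_Ioc
        fun y hy => cmp 1 ?_
      obtain ⟨h1, h2⟩ := hy
      have : (c - y) * (c + y) ≤ e * (2 * (1 + A)) := by
        refine (mul_le_mul_of_nonneg_left (?_ : c + y ≤ 2 * (A + e)) (by linarith)).trans ?_
        · linarith
        · calc (c - y) * (2 * (A + e)) ≤ e * (2 * (A + e)) := by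
                gcongr; linarith
            _ ≤ e * (2 * (1 + A)) := mul_le_mul_of_nonneg_left (by linarith) he
      nlinarith
    refine this.trans_eq ?_
    simp [hc, he]
  set h := (1 + A)⁻¹ with hh
  have h0 : 0 < h := by positivity
  have hA1 : h * (1 + A) = 1 := inv_mul_cancel₀ (by positivity)
  have low : h * φ c ≤ Real.exp 2 * (gaussianReal 0 1).real (Set.Ioi c) := by
    have sub : (gaussianReal 0 1).real (Set.Ioc c (c + h)) ≤ (gaussianReal 0 1).real (Set.Ioi c) :=
      measureReal_mono Set.Ioc_subset_Ioi_self
    refine le_trans ?_ (mul_le_mul_of_nonneg_left sub (Real.exp_pos 2).le)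
    rw [hP, ← integral_const_mul]
    have : ∫ x in Set.Ioc c (c + h), φ c ≤ ∫ x in Set.Ioc c (c + h), Real.exp 2 * φ x := by
      refine setIntegral_mono_on continuous_const.integrableOn_Ioc (hi.const_mul _).integrableOn measurableSet_Ioc
        fun y hy => cmp 2 ?_
      obtain ⟨h1, h2⟩ := hy
      have h1' : h ≤ 1 := by nlinarith
      have : (y - c) * (y + c) ≤ h * (2 * (1 + A) + 1) := by
        refine (mul_le_mul_of_nonneg_left (?_ : y + c ≤ 2 * (1 + A) + 1) (by linarith)).trans ?_
        · linarith
        · gcongr; linarith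
      nlinarith
    refine le_trans (le_of_eq ?_) this
    simp [h0.le]
  calc _ ≤ e * (Real.exp 1 * φ c) := up
    _ = e * (1 + A) * Real.exp 1 * (h * φ c) := by
        linear_combination (-(e * Real.exp 1 * φ c)) * hA1
    _ ≤ e * (1 + A) * Real.exp 1 * (Real.exp 2 * (gaussianReal 0 1).real (Set.Ioi c)) := by gcongr
    _ = _ := by
        rw [show (3 : ℝ) = 1 + 2 by norm_num, Real.exp_add]; ring

/-- Freezing the section at v enlarges the event on the left and shrinks the one on the right, as
`A` is monotone; independence then factors both. -/
theorem measureReal_mem_Ioc_inter_le {Ω F : Type*} [MeasurableSpace Ω] [MeasurableSpace F]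
    {P : Measure Ω} [IsProbabilityMeasure P] {T : Ω → ℝ} {R : Ω → F} (hTR : IndepFun T R P)
    {A : ℝ → Set F} (hA : Monotone A) (hAm : ∀ t, MeasurableSet (A t)) {u v c : ℝ}
    (hc : P.real {ω | T ω ∈ Set.Ioc u v} ≤ c * P.real {ω | T ω ∈ Set.Ioi v}) :
    P.real {ω | T ω ∈ Set.Ioc u v ∧ R ω ∈ A (T ω)} ≤
      c * P.real {ω | T ω ∈ Set.Ioi v ∧ R ω ∈ A (T ω)} := by
  have ind : ∀ s, MeasurableSet s → P.real {ω | T ω ∈ s ∧ R ω ∈ A v} =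
      P.real {ω | T ω ∈ s} * P.real {ω | R ω ∈ A v} := fun s hs => by
    have := hTR.measure_inter_preimage_eq_mul s (A v) hs (hAm v)
    simp only [measureReal_def]
    rw [← ENNReal.toReal_mul]
    exact congrArg ENNReal.toReal this
  rcases lt_or_ge c 0 with hc0 | hc0
  · have h0 : P.real {ω | T ω ∈ Set.Ioi v} = 0 := by
      have := measureReal_nonneg (μ := P) (s := {ω | T ω ∈ Set.Ioc u v})
      have := measureReal_nonneg (μ := P) (s := {ω | T ω ∈ Set.Ioi v})
      nlinarith
    have h1 : P.real {ω | T ω ∈ Set.Ioi v ∧ R ω ∈ A (T ω)} = 0 :=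
      le_antisymm ((measureReal_mono fun ω h => h.1).trans h0.le) measureReal_nonneg
    rw [h0, mul_zero] at hc
    rw [h1, mul_zero]
    exact (measureReal_mono fun ω h => h.1).trans hc
  have last : P.real {ω | T ω ∈ Set.Ioi v ∧ R ω ∈ A v} ≤
      P.real {ω | T ω ∈ Set.Ioi v ∧ R ω ∈ A (T ω)} :=
    measureReal_mono fun ω h => ⟨h.1, hA (Set.mem_Ioi.1 h.1).le h.2⟩
  calc _ ≤ P.real {ω | T ω ∈ Set.Ioc u v ∧ R ω ∈ A v} :=
        measureReal_mono fun ω h => ⟨h.1, hA h.1.2 h.2⟩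
    _ ≤ c * P.real {ω | T ω ∈ Set.Ioi v} * P.real {ω | R ω ∈ A v} := by
        rw [ind _ measurableSet_Ioc]; gcongr
    _ = c * P.real {ω | T ω ∈ Set.Ioi v ∧ R ω ∈ A v} := by
        rw [ind _ measurableSet_Ioi, mul_assoc]
    _ ≤ _ := mul_le_mul_of_nonneg_left last hc0

theorem covariance_eval {μ : Measure (Fin p → ℝ)} [IsGaussian μ] (h0 : ∀ j, ∫ z, z j ∂μ = 0)
    (j k : Fin p) : cov[fun z => z j, fun z => z k; μ] = ∫ z, z j * z k ∂μ := by
  simp [covariance, h0]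

theorem map_eval_eq_gaussianReal {μ : Measure (Fin p → ℝ)} [IsGaussian μ]
    (h0 : ∀ j, ∫ z, z j ∂μ = 0) (j : Fin p) :
    μ.map (fun z => z j) = gaussianReal 0 (∫ z, z j * z j ∂μ).toNNReal := by
  have := IsGaussian.map_eq_gaussianReal (μ := μ) (ContinuousLinearMap.proj j)
  rw [← covariance_eval h0, covariance_self (measurable_pi_apply j).aemeasurable]
  have e : ⇑(ContinuousLinearMap.proj j : (Fin p → ℝ) →L[ℝ] ℝ) = fun z => z j := rfl
  rw [e] at this
  simpa [h0] using this

/-- Regression residuals are uncorrelated with the regressor, and joint Gaussianity upgrades this to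
independence. -/
theorem indepFun_eval_residual {μ : Measure (Fin p → ℝ)} [IsGaussian μ]
    (h0 : ∀ j, ∫ z, z j ∂μ = 0) (j : Fin p) (h1 : ∫ z, z j * z j ∂μ = 1) :
    IndepFun (fun z : Fin p → ℝ => z j)
      (fun (z : Fin p → ℝ) k => z k - (∫ y, y j * y k ∂μ) * z j) μ := by
  set r : Fin p → ℝ := fun k => ∫ y, y j * y k ∂μ
  have hL : HasGaussianLaw (fun z : Fin p → ℝ =>
      (fun _ : Unit => z j, fun k => z k - r k * z j)) μ :=
    (IsGaussian.hasGaussianLaw_id (μ := μ)).map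
      ((ContinuousLinearMap.pi fun _ : Unit => ContinuousLinearMap.proj j).prod
        (ContinuousLinearMap.pi fun k => ContinuousLinearMap.proj k -
          r k • (ContinuousLinearMap.proj j : (Fin p → ℝ) →L[ℝ] ℝ)))
  have := hL.indepFun_of_covariance_eval (X := fun (_ : Unit) (z : Fin p → ℝ) => z j)
    (Y := fun k (z : Fin p → ℝ) => z k - r k * z j) fun _ k => by
      rw [covariance_fun_sub_right (memLp_eval μ j) (memLp_eval μ k)
        ((memLp_eval μ j).const_mul _), covariance_const_mul_right, covariance_eval h0,
        covariance_eval h0, h1]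
      simp [r]
  exact this.comp (φ := fun g : Unit → ℝ => g ()) (measurable_pi_apply _) measurable_id

theorem integral_eval_mul_le_one {μ : Measure (Fin p → ℝ)} [IsGaussian μ]
    (h1 : ∀ j, ∫ z, z j * z j ∂μ = 1) (j k : Fin p) : ∫ z, z j * z k ∂μ ≤ 1 := by
  have h : ∫ z, z j * z k ∂μ ≤ ∫ z, (z j * z j + z k * z k) / 2 ∂μ := by
    refine integral_mono (integrable_eval_mul μ j k)
      (((integrable_eval_mul μ j j).add (integrable_eval_mul μ k k)).div_const 2) fun z => ?_
    simp only
    nlinarith [sq_nonneg (z j - z k)]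
  rw [integral_div, integral_add (integrable_eval_mul μ j j) (integrable_eval_mul μ k k),
    h1, h1] at h
  linarith

/-- Breaking ties towards the smallest index makes the argmax events disjoint even for degenerate
laws. -/
theorem exists_first_argmax [NeZero p] (v : Fin p → ℝ) :
    ∃ j, ∀ k, (k < j → v k < v j) ∧ (j < k → v k ≤ v j) := by
  obtain ⟨m, -, hm⟩ := Finset.exists_max_image Finset.univ v Finset.univ_nonempty
  obtain ⟨j, hj, hmin⟩ := wellFounded_lt.has_min {j | ∀ k, v k ≤ v j} ⟨m, fun k => hm k (by simp)⟩
  refine ⟨j, fun k => ⟨fun hk => lt_of_not_ge fun hle => ?_, fun _ => hj k⟩⟩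
  exact hmin k (fun i => (hj i).trans hle) hk

/-- On the event that j is the first argmax of z - a, the window for the maximum becomes a window
for z j alone. Each such event is compared with the same argmax event beyond the window; those are
disjoint, so their probabilities sum to at most 1 and p never enters. -/
theorem measureReal_max_mem_Ioc_le_of_unit [NeZero p] {μ : Measure (Fin p → ℝ)} [IsGaussian μ]
    (h0 : ∀ j, ∫ z, z j ∂μ = 0) (h1 : ∀ j, ∫ z, z j * z j ∂μ = 1) {a : Fin p → ℝ} {e A : ℝ}
    (he : 0 ≤ e) (ha : ∀ j, |a j| ≤ A) :
    μ.real {z | (∃ j, a j < z j) ∧ ∀ j, z j ≤ a j + e} ≤ Real.exp 3 * (e * (1 + A)) := by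
  have A0 : 0 ≤ A := (abs_nonneg _).trans (ha 0)
  rcases le_or_gt (e * (1 + A)) 1 with hA | hA
  swap
  · refine measureReal_le_one.trans ?_
    have : 1 ≤ Real.exp 3 := Real.one_le_exp (by norm_num)
    nlinarith
  set c := Real.exp 3 * (e * (1 + A))
  have c0 : 0 ≤ c := by positivity
  set B : Fin p → (Fin p → ℝ) → Prop := fun j z =>
    ∀ k, (k < j → z k - a k < z j - a j) ∧ (j < k → z k - a k ≤ z j - a j)
  have step : ∀ j, μ.real {z | z j ∈ Set.Ioc (a j) (a j + e) ∧ B j z} ≤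
      c * μ.real {z | z j ∈ Set.Ioi (a j + e) ∧ B j z} := fun j => by
    set r : Fin p → ℝ := fun k => ∫ y, y j * y k ∂μ
    have hr : ∀ k, r k ≤ 1 := integral_eval_mul_le_one h1 j
    have law : ∀ s, MeasurableSet s → μ.real {z : Fin p → ℝ | z j ∈ s} =
        (gaussianReal 0 1).real s := fun s hs => by
      have := map_eval_eq_gaussianReal h0 j
      rw [h1, Real.toNNReal_one] at this
      rw [← this, map_measureReal_apply (by fun_prop) hs]
      rfl
    -- With residual ρ fixed and t = z j, the other coordinates are ρ k + r k t. Since r k ≤ 1,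
    -- raising t can only help j to be the argmax, which gives the required monotonicity.
    set D : ℝ → Set (Fin p → ℝ) := fun t => {ρ | ∀ k, (k < j → ρ k + r k * t - a k < t - a j) ∧
      (j < k → ρ k + r k * t - a k ≤ t - a j)}
    have hD : Monotone D := fun t t' ht ρ hρ k => by
      have : 0 ≤ (1 - r k) * (t' - t) := mul_nonneg (by linarith [hr k]) (by linarith)
      exact ⟨fun hk => by linarith [(hρ k).1 hk], fun hk => by linarith [(hρ k).2 hk]⟩
    have hDm : ∀ t, MeasurableSet (D t) := fun t => by
      simp only [D, measurableSet_setOfPred]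
      refine Measurable.forall fun k => Measurable.and (Measurable.imp measurable_const ?_)
        (Measurable.imp measurable_const ?_)
      · exact measurableSet_setOfPred.1 (measurableSet_lt (by fun_prop) measurable_const)
      · exact measurableSet_setOfPred.1 (measurableSet_le (by fun_prop) measurable_const)
    have := measureReal_mem_Ioc_inter_le (indepFun_eval_residual h0 j (h1 j)) hD hDm
      (u := a j) (v := a j + e) (c := c) (by
        rw [law _ measurableSet_Ioc, law _ measurableSet_Ioi]
        exact gaussianReal_Ioc_le_mul_Ioi he (ha j) hA)
    simpa only [D, B, Set.mem_ofPred_eq, r, sub_add_cancel] using this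
  have disj : Pairwise (Function.onFun Disjoint
      fun j => {z : Fin p → ℝ | z j ∈ Set.Ioi (a j + e) ∧ B j z}) := by
    have aux : ∀ i j z, i < j → B i z → B j z → False := fun i j z hij hi hj => by
      linarith [(hi j).2 hij, (hj i).1 hij]
    intro i j hij
    refine Set.disjoint_left.2 fun z hi hj => ?_
    rcases lt_or_gt_of_ne hij with h | h
    · exact aux i j z h hi.2 hj.2
    · exact aux j i z h hj.2 hi.2
  have meas : ∀ j, MeasurableSet {z : Fin p → ℝ | z j ∈ Set.Ioi (a j + e) ∧ B j z} := fun j => by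
    refine measurableSet_setOfPred.2 (Measurable.and (measurableSet_setOfPred.1
      (measurableSet_lt measurable_const (measurable_pi_apply j))) ?_)
    refine Measurable.forall fun k => Measurable.and (Measurable.imp measurable_const ?_)
      (Measurable.imp measurable_const ?_)
    · exact measurableSet_setOfPred.1 (measurableSet_lt (by fun_prop) (by fun_prop))
    · exact measurableSet_setOfPred.1 (measurableSet_le (by fun_prop) (by fun_prop))
  calc _ ≤ μ.real (⋃ j, {z : Fin p → ℝ | z j ∈ Set.Ioc (a j) (a j + e) ∧ B j z}) := by
        refine measureReal_mono fun z hz => ?_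
        obtain ⟨⟨i, hi⟩, hz⟩ := hz
        obtain ⟨j, hj⟩ := exists_first_argmax fun k => z k - a k
        refine Set.mem_iUnion.2 ⟨j, ⟨?_, hz j⟩, hj⟩
        rcases lt_trichotomy i j with h | h | h
        · linarith [(hj i).1 h]
        · rwa [← h]
        · linarith [(hj i).2 h]
    _ ≤ ∑ j, μ.real {z | z j ∈ Set.Ioc (a j) (a j + e) ∧ B j z} := measureReal_iUnion_fintype_le _
    _ ≤ ∑ j, c * μ.real {z | z j ∈ Set.Ioi (a j + e) ∧ B j z} :=
        Finset.sum_le_sum fun j _ => step j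
    _ = c * μ.real (⋃ j, {z | z j ∈ Set.Ioi (a j + e) ∧ B j z}) := by
        rw [← Finset.mul_sum, measureReal_iUnion_fintype disj meas]
    _ ≤ c := mul_le_of_le_one_right c0 measureReal_le_one

/-- Standardizing the coordinates turns the common level x into levels x/σ j, which is why the
unit-variance case allows a vector of levels; the windows ε/σ j are enlarged to ε/√s. -/
theorem measureReal_max_mem_Ioc_le [NeZero p] {μ : Measure (Fin p → ℝ)} [IsGaussian μ]
    (h0 : ∀ j, ∫ z, z j ∂μ = 0) {s : ℝ} (hs : 0 < s) (h1 : ∀ j, s ≤ ∫ z, z j * z j ∂μ)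
    {x ε : ℝ} (hε : 0 ≤ ε) :
    μ.real {z | (∃ j, x < z j) ∧ ∀ j, z j ≤ x + ε} ≤
      Real.exp 3 * (ε / Real.sqrt s * (1 + |x| / Real.sqrt s)) := by
  set σ : Fin p → ℝ := fun j => Real.sqrt (∫ z, z j * z j ∂μ)
  have hσ : ∀ j, Real.sqrt s ≤ σ j := fun j => Real.sqrt_le_sqrt (h1 j)
  have s0 : 0 < Real.sqrt s := Real.sqrt_pos.2 hs
  have σ0 : ∀ j, 0 < σ j := fun j => s0.trans_le (hσ j)
  have hsq : ∀ j, σ j ^ 2 = ∫ z, z j * z j ∂μ := fun j =>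
    Real.sq_sqrt (hs.le.trans (h1 j))
  set L : (Fin p → ℝ) →L[ℝ] (Fin p → ℝ) := ContinuousLinearMap.pi fun j =>
    (σ j)⁻¹ • ContinuousLinearMap.proj j
  have hL : ∀ z j, L z j = (σ j)⁻¹ * z j := fun z j => by simp [L]
  have int : ∀ f : (Fin p → ℝ) → ℝ, Continuous f → ∫ z, f z ∂(μ.map L) = ∫ z, f (L z) ∂μ :=
    fun f hf => integral_map (by fun_prop) hf.aestronglyMeasurable
  have := measureReal_max_mem_Ioc_le_of_unit (μ := μ.map L) (a := fun j => (σ j)⁻¹ * x)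
    (e := ε / Real.sqrt s) (A := |x| / Real.sqrt s)
    (fun j => by
      rw [int _ (by fun_prop)]
      simp only [hL]
      rw [integral_const_mul, h0, mul_zero])
    (fun j => by
      rw [int _ (by fun_prop)]
      have : ∀ z, L z j * L z j = (σ j ^ 2)⁻¹ * (z j * z j) := fun z => by
        rw [hL]; field_simp
      simp only [this]
      rw [integral_const_mul, ← hsq]
      exact inv_mul_cancel₀ (pow_pos (σ0 j) 2).ne')
    (by positivity)
    (fun j => by
      rw [abs_mul, abs_of_pos (inv_pos.2 (σ0 j)), mul_comm, ← div_eq_mul_inv]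
      have := hσ j
      gcongr)
  refine le_trans ?_ this
  rw [map_measureReal_apply (by fun_prop)]
  · refine measureReal_mono fun z hz => ?_
    obtain ⟨⟨i, hi⟩, hz⟩ := hz
    refine ⟨⟨i, ?_⟩, fun j => ?_⟩
    · rw [hL]
      exact mul_lt_mul_of_pos_left hi (inv_pos.2 (σ0 i))
    · rw [hL]
      have h2 : (σ j)⁻¹ * z j ≤ (σ j)⁻¹ * (x + ε) :=
        mul_le_mul_of_nonneg_left (hz j) (inv_pos.2 (σ0 j)).le
      have h3 : (σ j)⁻¹ * ε ≤ ε / Real.sqrt s := by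
        rw [mul_comm, ← div_eq_mul_inv]
        have := hσ j
        gcongr
      rw [mul_add] at h2
      linarith
  · refine measurableSet_setOfPred.2 (Measurable.and ?_ ?_)
    · exact Measurable.exists fun j =>
        measurableSet_setOfPred.1 (measurableSet_lt (by fun_prop) (by fun_prop))
    · exact Measurable.forall fun j =>
        measurableSet_setOfPred.1 (measurableSet_le (by fun_prop) (by fun_prop))

theorem measureReal_exists_le_abs_le {μ : Measure (Fin p → ℝ)} [IsGaussian μ]
    (h0 : ∀ j, ∫ z, z j ∂μ = 0) {S : ℝ} (hS : 0 ≤ S) (h1 : ∀ j, ∫ z, z j * z j ∂μ ≤ S)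
    {t : ℝ} (ht : 0 ≤ t) :
    μ.real {z | ∃ j, t ≤ |z j|} ≤ 2 * p * Real.exp (-t ^ 2 / (2 * S)) := by
  have sub : ∀ j, HasSubgaussianMGF (fun z : Fin p → ℝ => z j) S.toNNReal μ := fun j => by
    have law := map_eval_eq_gaussianReal h0 j
    refine ⟨fun t => ?_, fun t => ?_⟩
    · have := integrable_exp_mul_gaussianReal (μ := 0) (v := (∫ z, z j * z j ∂μ).toNNReal) t
      rw [← law] at this
      exact this.comp_measurable (measurable_pi_apply j)
    · rw [mgf_gaussianReal law, Real.coe_toNNReal _ hS, zero_mul, zero_add]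
      refine Real.exp_le_exp.2 ?_
      have : ((∫ z, z j * z j ∂μ).toNNReal : ℝ) ≤ S := by
        rw [Real.coe_toNNReal']; exact max_le (h1 j) hS
      gcongr
  have one : ∀ j, μ.real {z | t ≤ |z j|} ≤ 2 * Real.exp (-t ^ 2 / (2 * S)) := fun j => by
    have a := (sub j).measure_ge_le ht
    have b := (sub j).neg.measure_ge_le ht
    rw [Real.coe_toNNReal _ hS] at a b
    calc μ.real {z | t ≤ |z j|} ≤
        μ.real ({z : Fin p → ℝ | t ≤ z j} ∪ {z | t ≤ (-fun z : Fin p → ℝ => z j) z}) :=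
          measureReal_mono fun z (hz : t ≤ |z j|) => le_abs.1 hz
      _ ≤ _ := measureReal_union_le _ _
      _ ≤ 2 * Real.exp (-t ^ 2 / (2 * S)) := by linarith
  calc _ = μ.real (⋃ j, {z | t ≤ |z j|}) := by congr 1; ext; simp
    _ ≤ ∑ j, μ.real {z | t ≤ |z j|} := measureReal_iUnion_fintype_le _
    _ ≤ ∑ _j : Fin p, 2 * Real.exp (-t ^ 2 / (2 * S)) := Finset.sum_le_sum fun j _ => one j
    _ = _ := by simp; ring

/-- This removes the dependence on x. For |x| above the threshold, some coordinate has modulus at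
least |x| - ε ≥ √(2Sl), and the union bound for Gaussian tails gives 2p exp(-l). -/
theorem measureReal_max_mem_Ioc_le_log [NeZero p] {μ : Measure (Fin p → ℝ)} [IsGaussian μ]
    (h0 : ∀ j, ∫ z, z j ∂μ = 0) {s S : ℝ} (hs : 0 < s) (h1 : ∀ j, s ≤ ∫ z, z j * z j ∂μ)
    (h2 : ∀ j, ∫ z, z j * z j ∂μ ≤ S) {x ε l : ℝ} (hε : 0 ≤ ε) (hl : 0 ≤ l)
    (hεl : ε ≤ 2 * Real.sqrt l) :
    μ.real {z | (∃ j, x < z j) ∧ ∀ j, z j ≤ x + ε} ≤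
      Real.exp 3 * (ε / Real.sqrt s *
        (1 + (Real.sqrt (2 * S) + 2) * Real.sqrt l / Real.sqrt s)) + 2 * p * Real.exp (-l) := by
  have hS : 0 < S := hs.trans_le ((h1 0).trans (h2 0))
  rcases le_or_gt |x| ((Real.sqrt (2 * S) + 2) * Real.sqrt l) with hx | hx
  · refine (measureReal_max_mem_Ioc_le h0 hs h1 hε).trans ?_
    have : Real.exp 3 * (ε / Real.sqrt s * (1 + |x| / Real.sqrt s)) ≤ Real.exp 3 *
        (ε / Real.sqrt s * (1 + (Real.sqrt (2 * S) + 2) * Real.sqrt l / Real.sqrt s)) := by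
      gcongr
    refine this.trans (le_add_of_nonneg_right (by positivity))
  · set t := Real.sqrt (2 * S) * Real.sqrt l
    have ht : t ≤ |x| - ε := by
      rw [add_mul] at hx
      linarith
    have t0 : 0 ≤ t := by positivity
    refine le_trans (le_trans (measureReal_mono fun z hz => ?_)
      (measureReal_exists_le_abs_le h0 hS.le h2 t0)) (le_trans (le_of_eq ?_)
        (le_add_of_nonneg_left (by positivity)))
    · obtain ⟨⟨j, hj⟩, hz⟩ := hz
      refine ⟨j, ht.trans ?_⟩
      have := hz j
      rcases abs_cases x with ⟨hx, _⟩ | ⟨hx, _⟩ <;> rw [hx]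
      · exact le_trans (by linarith) (le_abs_self _)
      · exact le_trans (by linarith) (neg_le_abs _)
    · rw [mul_pow, Real.sq_sqrt (by positivity), Real.sq_sqrt hl, neg_div,
        mul_div_cancel_left₀ _ (by positivity)]

/-! ### Smoothing the indicator and choosing parameters -/

theorem measurableSet_forall_le {p : ℕ} (x : ℝ) :
    MeasurableSet {z : Fin p → ℝ | ∀ j, z j ≤ x} :=
  measurableSet_setOfPred.2 (Measurable.forall fun j =>
    measurableSet_setOfPred.1 (measurableSet_le (measurable_pi_apply j) measurable_const))

theorem exists_measureReal_max_le_shift : ∃ K : ℝ, 0 < K ∧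
    ∀ {p : ℕ} [NeZero p] (μ ν : Measure (Fin p → ℝ)) [IsGaussian μ] [IsGaussian ν],
    (∀ j, ∫ z, z j ∂μ = 0) → (∀ j, ∫ z, z j ∂ν = 0) → ∀ {Δ : ℝ},
    (∀ j k, |∫ z, z j * z k ∂μ - ∫ z, z j * z k ∂ν| ≤ Δ) → ∀ {δ b : ℝ}, 0 < δ → 0 < b → ∀ x : ℝ,
    μ.real {z | ∀ j, z j ≤ x} ≤ ν.real {z | ∀ j, z j ≤ x + (δ + Real.log p / b)} +
      (K / δ ^ 2 + 2 * b * (K / δ)) * Δ / 2 := by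
  obtain ⟨K, K0, h, h₁, h₂, h₃, d₁, d₂, d₃, k₁, k₂, k₃, b₀, b₁, hl, hr⟩ := exists_smooth_step
  refine ⟨K, K0, fun {p} _ μ ν _ _ hμ hν {Δ} hΔ {δ b} hδ hb x => ?_⟩
  -- With this shift the smoothed function is 1 wherever max ≤ x and 0 wherever max > t + δ.
  set t := x + Real.log p / b
  have arg : ∀ u : ℝ, HasDerivAt (fun u => (u - t) / δ) (1 / δ) u := fun u =>
    ((hasDerivAt_id u).sub_const t).div_const δ
  have bd : ∀ {g : ℝ → ℝ} (n : ℕ), (∀ u, |g u| ≤ K) →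
      ∀ u, |g ((u - t) / δ) / δ ^ n| ≤ K / δ ^ n := fun n hg u => by
    rw [abs_div, abs_of_pos (pow_pos hδ n)]
    gcongr
    exact hg _
  have e₁ : ∀ u, HasDerivAt (fun u => h ((u - t) / δ)) (h₁ ((u - t) / δ) / δ ^ 1) u := fun u => by
    convert! (d₁ _).comp u (arg u) using 1
    field_simp
  have e₂ : ∀ u, HasDerivAt (fun u => h₁ ((u - t) / δ) / δ ^ 1) (h₂ ((u - t) / δ) / δ ^ 2) u :=
    fun u => by
      convert! ((d₂ _).comp u (arg u)).div_const (δ ^ 1) using 1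
      field_simp
  have e₃ : ∀ u, HasDerivAt (fun u => h₂ ((u - t) / δ) / δ ^ 2) (h₃ ((u - t) / δ) / δ ^ 3) u :=
    fun u => by
      convert! ((d₃ _).comp u (arg u)).div_const (δ ^ 2) using 1
      field_simp
  have hb1 := bd 1 k₁
  have hb2 := bd 2 k₂
  have hb3 := bd 3 k₃
  have p1 : 0 ≤ K / δ ^ 1 := by positivity
  have p2 : 0 ≤ K / δ ^ 2 := by positivity
  have p3 : 0 ≤ K / δ ^ 3 := by positivity
  -- The sum is a common bound for the three derivatives; it does not enter the conclusion, where
  -- only `hb1` and `hb2` count.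
  have cmp := abs_integral_softMax_sub_le hb e₁ e₂ e₃ (K := K / δ ^ 1 + K / δ ^ 2 + K / δ ^ 3)
    (fun u => (hb1 u).trans (by linarith)) (fun u => (hb2 u).trans (by linarith))
    (fun u => (hb3 u).trans (by linarith)) (fun u => b₀ _) (fun u => b₁ _) hb1 hb2 μ ν hμ hν hΔ
  rw [pow_one] at cmp
  have cont : Continuous fun z : Fin p → ℝ => h ((softMax b z - t) / δ) := by
    have ch : Continuous h := continuous_iff_continuousAt.2 fun u => (d₁ u).continuousAt
    exact ch.comp (((continuous_softMax b).sub continuous_const).div_const δ)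
  have int : ∀ (ρ : Measure (Fin p → ℝ)) [IsFiniteMeasure ρ],
      Integrable (fun z => h ((softMax b z - t) / δ)) ρ := fun ρ _ =>
    integrable_of_mem_Icc ρ cont (fun _ => b₀ _) (fun _ => b₁ _)
  have lo : μ.real {z | ∀ j, z j ≤ x} ≤ ∫ z, h ((softMax b z - t) / δ) ∂μ := by
    rw [← integral_indicator_one (measurableSet_forall_le x)]
    refine integral_mono ((integrable_const 1).indicator (measurableSet_forall_le x)) (int μ) ?_
    refine fun z => Set.indicator_apply_le' (fun hz => ?_) (fun _ => b₀ _)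
    exact (hl _ (div_nonpos_of_nonpos_of_nonneg (sub_nonpos.2 (softMax_le hb z x hz)) hδ.le)).ge
  have up : ∫ z, h ((softMax b z - t) / δ) ∂ν ≤
      ν.real {z | ∀ j, z j ≤ x + (δ + Real.log p / b)} := by
    rw [← integral_indicator_one (measurableSet_forall_le _)]
    refine integral_mono (int ν) ((integrable_const 1).indicator (measurableSet_forall_le _)) ?_
    refine fun z => Set.le_indicator_apply (fun _ => b₁ _) (fun hz => le_of_eq (hr _ ?_))
    rw [one_le_div hδ]
    by_contra! hlt
    exact hz fun j => by linarith [le_softMax hb z j]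
  linarith [(abs_le.1 cmp).2]

theorem measureReal_max_le_add {p : ℕ} {μ : Measure (Fin p → ℝ)} [IsFiniteMeasure μ] (x ε : ℝ) :
    μ.real {z | ∀ j, z j ≤ x + ε} ≤
      μ.real {z | ∀ j, z j ≤ x} + μ.real {z | (∃ j, x < z j) ∧ ∀ j, z j ≤ x + ε} := by
  refine (measureReal_mono fun z hz => ?_).trans (measureReal_union_le _ _)
  by_cases h : ∀ j, z j ≤ x
  · exact Or.inl h
  · push Not at h
    exact Or.inr ⟨h, hz⟩

theorem comparisonRate_pow_three {p : ℕ} {Δ : ℝ} (hΔ : 0 < Δ) :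
    0 < comparisonRate p Δ ∧
      comparisonRate p Δ ^ 3 = Δ * max 1 (Real.log (p / Δ)) ^ 2 := by
  have hL : 0 < max 1 (Real.log (p / Δ)) := by positivity
  rw [comparisonRate, if_neg hΔ.ne']
  refine ⟨by positivity, ?_⟩
  rw [mul_pow, ← Real.rpow_natCast, ← Real.rpow_natCast, ← Real.rpow_mul hΔ.le,
    ← Real.rpow_mul hL.le, ← Real.rpow_natCast]
  norm_num

theorem exists_abs_measureReal_max_le_sub_le : ∃ K : ℝ, 0 < K ∧
    ∀ {p : ℕ}, 2 ≤ p → ∀ (μ ν : Measure (Fin p → ℝ)) [IsGaussian μ] [IsGaussian ν],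
    (∀ j, ∫ z, z j ∂μ = 0) → (∀ j, ∫ z, z j ∂ν = 0) → ∀ {Δ s S : ℝ}, 0 ≤ Δ →
    (∀ j k, |∫ z, z j * z k ∂μ - ∫ z, z j * z k ∂ν| ≤ Δ) → 0 < s →
    (∀ j, s ≤ ∫ z, z j * z j ∂ν) → (∀ j, ∫ z, z j * z j ∂ν ≤ S) → ∀ x : ℝ,
    |μ.real {z | ∀ j, z j ≤ x} - ν.real {z | ∀ j, z j ≤ x}| ≤
      (K + Real.exp 3 * (2 / Real.sqrt s * (1 + (Real.sqrt (2 * S) + 2) / Real.sqrt s))) *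
        comparisonRate p Δ := by
  obtain ⟨K, K0, hK⟩ := exists_measureReal_max_le_shift
  -- The term 3K/2 pays for smoothing; 3 covers both the tail 2p exp(-L) ≤ 2Δ ≤ 2r and the trivial
  -- bound 1 ≤ r when Δ ≥ 1.
  refine ⟨3 + 3 / 2 * K, by positivity,
    fun {p} hp μ ν _ _ hμ hν {Δ s S} hΔ0 hΔ hs hsν hSν x => ?_⟩
  have : NeZero p := ⟨by omega⟩
  have s0 : 0 < Real.sqrt s := Real.sqrt_pos.2 hs
  have hp' : (2 : ℝ) ≤ p := by exact_mod_cast hp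
  have lp : 0 < Real.log p := Real.log_pos (by linarith)
  -- The one-sided bound is used at x from μ to ν and at x - 2δ from ν to μ, so both windows are
  -- measured under ν. The choice b = log p / δ makes the two smoothing shifts equal.
  have two : ∀ {δ : ℝ}, 0 < δ → ∀ {T : ℝ},
      (∀ y, |y| ≤ |x| + 2 * δ → ν.real {z | (∃ j, y < z j) ∧ ∀ j, z j ≤ y + 2 * δ} ≤ T) →
      |μ.real {z | ∀ j, z j ≤ x} - ν.real {z | ∀ j, z j ≤ x}| ≤
        T + K * (1 + 2 * Real.log p) / δ ^ 2 * Δ / 2 := fun {δ} hδ {T} hT => by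
    have hb : 0 < Real.log p / δ := by positivity
    have e1 : δ + Real.log p / (Real.log p / δ) = 2 * δ := by field_simp; ring
    have e2 : (K / δ ^ 2 + 2 * (Real.log p / δ) * (K / δ)) * Δ / 2 =
      K * (1 + 2 * Real.log p) / δ ^ 2 * Δ / 2 := by field_simp
    have a := hK μ ν hμ hν hΔ hδ hb x
    have b := hK ν μ hν hμ (fun j k => by rw [abs_sub_comm]; exact hΔ j k) hδ hb (x - 2 * δ)
    rw [e1, e2] at a b
    have c := measureReal_max_le_add (μ := ν) x (2 * δ)
    have d := measureReal_max_le_add (μ := ν) (x - 2 * δ) (2 * δ)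
    have c' := hT x (by linarith)
    have d' := hT (x - 2 * δ) ((abs_sub _ _).trans (by rw [abs_of_pos (by positivity : 0 < 2 * δ)]))
    rw [sub_add_cancel] at b d d'
    rw [abs_le]
    constructor <;> linarith
  rcases hΔ0.eq_or_lt with rfl | hΔp
  -- For Δ = 0 only the window probability is left, and it vanishes as δ → 0 with x fixed.
  · rw [comparisonRate, if_pos rfl, mul_zero]
    have lim : Filter.Tendsto (fun δ : ℝ => Real.exp 3 *
        (2 * δ / Real.sqrt s * (1 + (|x| + 2 * δ) / Real.sqrt s))) (nhdsWithin 0 (Set.Ioi 0))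
        (nhds 0) := by
      refine Filter.Tendsto.mono_left (Continuous.tendsto' ?_ _ _ (by simp)) nhdsWithin_le_nhds
      fun_prop
    refine ge_of_tendsto lim ?_
    filter_upwards [self_mem_nhdsWithin] with δ hδ
    have hδ : 0 < δ := hδ
    have := two hδ (T := Real.exp 3 *
        (2 * δ / Real.sqrt s * (1 + (|x| + 2 * δ) / Real.sqrt s))) fun y hy => by
      refine (measureReal_max_mem_Ioc_le hν hs hsν (by positivity)).trans ?_
      gcongr
    simpa using this
  obtain ⟨r0, r3⟩ := comparisonRate_pow_three (p := p) hΔp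
  set r := comparisonRate p Δ
  set L := max 1 (Real.log (p / Δ))
  have L1 : 1 ≤ L := le_max_left _ _
  have Q0 : 0 ≤ Real.exp 3 * (2 / Real.sqrt s * (1 + (Real.sqrt (2 * S) + 2) / Real.sqrt s)) := by
    positivity
  have hrΔ : ∀ {a : ℝ}, a ^ 3 ≤ Δ * L ^ 2 → a ≤ r := fun {a} h =>
    le_of_pow_le_pow_left₀ (by norm_num : (3 : ℕ) ≠ 0) r0.le (r3 ▸ h)
  have hΔL : Δ ≤ Δ * L ^ 2 := le_mul_of_one_le_right hΔ0 (one_le_pow₀ L1)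
  rcases le_or_gt 1 Δ with h1 | h1
  · have r1 : 1 ≤ r := hrΔ (by linarith)
    have : |μ.real {z | ∀ j, z j ≤ x} - ν.real {z | ∀ j, z j ≤ x}| ≤ 1 :=
      abs_sub_le_of_nonneg_of_le measureReal_nonneg measureReal_le_one measureReal_nonneg
        measureReal_le_one
    refine this.trans (r1.trans (le_mul_of_one_le_left r0.le ?_))
    linarith
  have q0 : 0 < Real.sqrt L := Real.sqrt_pos.2 (by linarith)
  have q1 : 1 ≤ Real.sqrt L := Real.one_le_sqrt.2 L1
  have qq : Real.sqrt L * Real.sqrt L = L := Real.mul_self_sqrt (by linarith)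
  -- The width δ = r/√L turns the window bound δ √L into r and, by r³ = Δ L², the smoothing error L
  -- Δ/δ² into r as well.
  have hδ : 0 < r / Real.sqrt L := by positivity
  have lpL : Real.log p ≤ L := by
    refine le_trans (Real.log_le_log (by linarith) ?_) (le_max_right _ _)
    rw [le_div_iff₀ hΔp]
    nlinarith
  -- Needed for 2δ ≤ 2√L, the width condition of `measureReal_max_mem_Ioc_le_log`.
  have rL : r ≤ L := le_of_pow_le_pow_left₀ (by norm_num : (3 : ℕ) ≠ 0) (by linarith) (by
    rw [r3, pow_succ' L 2]
    gcongr
    linarith)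
  have Δr : Δ ≤ r := hrΔ (le_trans (by nlinarith [mul_pos hΔp hΔp]) hΔL)
  have pe : p * Real.exp (-L) ≤ Δ := by
    have h2 : p / Δ ≤ Real.exp L := by
      rw [← Real.log_le_iff_le_exp (by positivity)]
      exact le_max_right _ _
    rw [Real.exp_neg, ← div_eq_mul_inv, div_le_iff₀ (Real.exp_pos _)]
    rwa [div_le_iff₀ hΔp, mul_comm] at h2
  have main := two hδ fun y _ => measureReal_max_mem_Ioc_le_log hν hs hsν hSν (x := y) (l := L)
    (by positivity) (by linarith) (mul_le_mul_of_nonneg_left ((div_le_iff₀ q0).2 (by rwa [qq]))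
      (by norm_num))
  refine main.trans ?_
  have t1 : 2 * (r / Real.sqrt L) / Real.sqrt s *
      (1 + (Real.sqrt (2 * S) + 2) * Real.sqrt L / Real.sqrt s) ≤
      2 / Real.sqrt s * (1 + (Real.sqrt (2 * S) + 2) / Real.sqrt s) * r := by
    have e : 2 * (r / Real.sqrt L) / Real.sqrt s *
      (1 + (Real.sqrt (2 * S) + 2) * Real.sqrt L / Real.sqrt s) =
      2 / Real.sqrt s * (r / Real.sqrt L + (Real.sqrt (2 * S) + 2) / Real.sqrt s * r) := by
      field_simp
    have hle : r / Real.sqrt L ≤ r := div_le_self r0.le q1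
    rw [e, mul_assoc, add_mul, one_mul]
    gcongr
  have t2 : K * (1 + 2 * Real.log p) / (r / Real.sqrt L) ^ 2 * Δ / 2 ≤ 3 / 2 * K * r := by
    have e : K * (1 + 2 * Real.log p) / (r / Real.sqrt L) ^ 2 * Δ / 2 =
        K / 2 * ((1 + 2 * Real.log p) * (L * Δ / r ^ 2)) := by
      rw [div_pow, pow_two (Real.sqrt L), qq]; field_simp
    have e' : r = L * (L * Δ / r ^ 2) := by
      field_simp
      rw [r3, mul_comm]
    rw [e]
    have h3 : (1 + 2 * Real.log p) * (L * Δ / r ^ 2) ≤ 3 * L * (L * Δ / r ^ 2) := by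
      gcongr
      linarith
    rw [mul_assoc, ← e'] at h3
    calc K / 2 * ((1 + 2 * Real.log p) * (L * Δ / r ^ 2)) ≤ K / 2 * (3 * r) := by gcongr
      _ = _ := by ring
  have t3 := mul_le_mul_of_nonneg_left t1 (Real.exp_pos 3).le
  linarith

/-! ### Transfer to random vectors and the main theorem -/

section

variable {Ω : Type*} [MeasurableSpace Ω] {p : ℕ} {X : Ω → Fin p → ℝ} {P : Measure Ω}

theorem IsCenteredGaussianVector.integral_map_eval (hX : IsCenteredGaussianVector X P)
    (j : Fin p) : ∫ z, z j ∂(P.map X) = 0 := by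
  rw [integral_map hX.hasGaussianLaw.aemeasurable (measurable_pi_apply j).aestronglyMeasurable]
  exact hX.centered j

theorem IsCenteredGaussianVector.covarianceMatrix_apply (hX : IsCenteredGaussianVector X P)
    (j k : Fin p) : covarianceMatrix X P j k = ∫ z, z j * z k ∂(P.map X) := by
  rw [integral_map hX.hasGaussianLaw.aemeasurable (by fun_prop)]
  simp [covarianceMatrix, covariance, hX.centered]

theorem IsCenteredGaussianVector.measureReal_maxCoord_le [NeZero p]
    (hX : IsCenteredGaussianVector X P) (x : ℝ) :
    P.real {ω | maxCoord (X ω) ≤ x} = (P.map X).real {z | ∀ j, z j ≤ x} := by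
  rw [measureReal_def, measureReal_def,
    Measure.map_apply_of_aemeasurable hX.hasGaussianLaw.aemeasurable (measurableSet_forall_le x)]
  congr 2
  ext ω
  exact ciSup_le_iff (f := X ω) (Set.finite_range (X ω)).bddAbove

end

theorem abs_sub_le_maxEntryDiff {p : ℕ} (A B : Matrix (Fin p) (Fin p) ℝ) (j k : Fin p) :
    |A j k - B j k| ≤ maxEntryDiff A B :=
  (le_ciSup (f := fun k => |A j k - B j k|) (Set.finite_range _).bddAbove k).trans
    (le_ciSup (f := fun j => ⨆ k, |A j k - B j k|) (Set.finite_range _).bddAbove j)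

theorem mainTheorem2 :
    ∃ C : ℝ → ℝ → ℝ, (∀ a b : ℝ, 0 < C a b) ∧
      ∀ {Ω Ω' : Type*} [MeasurableSpace Ω] [MeasurableSpace Ω']
        (P : Measure Ω) (Q : Measure Ω') [IsProbabilityMeasure P] [IsProbabilityMeasure Q]
        (p : ℕ) (_hp : 2 ≤ p) (X : Ω → Fin p → ℝ) (Y : Ω' → Fin p → ℝ)
        (_hX : IsCenteredGaussianVector X P) (_hY : IsCenteredGaussianVector Y Q)
        (_hσ : ∀ j, 0 < covarianceMatrix Y Q j j),
        kolmogorovDist (fun ω => maxCoord (X ω)) P (fun ω => maxCoord (Y ω)) Q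
          ≤ C (⨅ j, covarianceMatrix Y Q j j) (⨆ j, covarianceMatrix Y Q j j)
            * comparisonRate p (maxEntryDiff (covarianceMatrix X P) (covarianceMatrix Y Q)) := by
  obtain ⟨K, K0, hK⟩ := exists_abs_measureReal_max_le_sub_le
  -- Positive for all real a and b, because K > 0 and the other summand is nonnegative even with the
  -- default values √a = 0 for a ≤ 0 and 2/0 = 0.
  refine ⟨fun a b => K + Real.exp 3 *
    (2 / Real.sqrt a * (1 + (Real.sqrt (2 * b) + 2) / Real.sqrt a)), fun a b => by positivity,
    fun {Ω Ω'} _ _ P Q _ _ p hp X Y hX hY hσ => ?_⟩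
  have : NeZero p := ⟨by omega⟩
  have := hX.hasGaussianLaw.isGaussian_map
  have := hY.hasGaussianLaw.isGaussian_map
  refine ciSup_le fun x => ?_
  rw [hX.measureReal_maxCoord_le, hY.measureReal_maxCoord_le]
  refine hK hp _ _ hX.integral_map_eval hY.integral_map_eval
    ((abs_nonneg _).trans (abs_sub_le_maxEntryDiff _ _ 0 0)) (fun j k => ?_) ?_ (fun j => ?_)
    (fun j => ?_) x
  · rw [← hX.covarianceMatrix_apply, ← hY.covarianceMatrix_apply]
    exact abs_sub_le_maxEntryDiff _ _ j k
  · obtain ⟨j, hj⟩ := exists_eq_ciInf_of_finite (f := fun j => covarianceMatrix Y Q j j)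
    rw [← hj]
    exact hσ j
  · rw [← hY.covarianceMatrix_apply]
    exact ciInf_le (f := fun j => covarianceMatrix Y Q j j) (Set.finite_range _).bddBelow j
  · rw [← hY.covarianceMatrix_apply]
    exact le_ciSup (f := fun j => covarianceMatrix Y Q j j) (Set.finite_range _).bddAbove j
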